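/- A \emph{subordination lattice} is a pair $\mathbb S=(A,\prec)$ where $A$ is a bounded distributive lattice and $\prec\,\subseteq A\times A$ satisfies: $\bot\prec\bot$; $\top\prec\top$; $a\le b\prec x\Rightarrow a\prec x$; $b\prec x\le y\Rightarrow b\prec y$; $a\prec x\ \&\ a\prec y\Rightarrow a\prec x\wedge y$; $a\prec x\ \&\ b\prec x\Rightarrow a\vee b\prec x$. Consider the conditions (D) $a\prec c\Rightarrow\exists b\,(a\prec b\ \&\ b\prec c)$, and (T) $a\prec b\ \&\ b\prec c\Rightarrow a\prec c$. Let $A^\delta$ be the canonical extension of $A$, i.e. a complete lattice containing $A$ as a subposet that is \emph{dense} (every element of $A^\delta$ is a join of closed elements and a meet of open elements, where a closed (resp. open) element is the meet (resp. join) in $A^\delta$ of a nonempty down-directed (resp. up-directed) subset of $A$) and \emph{compact} (if $F\subseteq A$ is nonempty and down-directed, $I\subseteq A$ is nonempty and up-directed and $\bigwedge F\le\bigvee I$, then $a\le b$ for some $a\in F$, $b\in I$). For $a\in A$ put $\Diamond a=\bigwedge\{b\in A\mid a\prec b\}$ and $\blacksquare a=\bigvee\{b\in A\mid b\prec a\}$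 in $A^\delta$; extend $\Diamond$ to $A^\delta$ by $\Diamond k=\bigwedge\{\Diamond a\mid a\in A,\ k\le a\}$ for closed $k$ and $\Diamond u=\bigvee\{\Diamond k\mid k\text{ closed},\ k\le u\}$ for arbitrary $u$. Let $X(A)$ be the set of (proper) prime filters of $A$, ordered by inclusion, with the Priestley topology (generated by the sets $\{P\mid a\in P\}$ and their complements, $a\in A$), and for $P,Q\in X(A)$ let $$(P,Q)\in R_\prec\iff\{x\in A\mid\exists a\in P,\ a\prec x\}\subseteq Q .$$ Let $J^\infty(A^\delta)$ be the set of completely join-irreducible elements of $A^\delta$, ordered by the reverse of the order of $A^\delta$, with the topology generated by the sets $\{j\mid j\le a\}$ and their complements, $a\in A$, and for $j,i\in J^\infty(A^\delta)$ let $(j,i)\in R_\prec$ iff $i\le\Diamond j$. A relation $R$ on either of these spaces $X$ is called \emph{proper} if for every closed down-set $Y\subsetneq X$ there is $P\in X$ with $P\notin R^{-1}[Y]=\{P\mid\exists Q\in Y,\ (P,Q)\in R\}$. \textbf{Proposition.} Let $\mathbb S=(A,\prec)$ be a subordination lattice. The map $P\mapsto\bigwedge P$ is an isomorphism (bijective,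 order-preserving and order-reflecting, homeomorphic, and preserving and reflecting $R_\prec$) from $X(A)$ onto $J^\infty(A^\delta)$. Moreover, for $R_\prec$ on $J^\infty(A^\delta)$, and likewise for $R_\prec$ on $X(A)$: (i) ${\prec}\subseteq{\le}$ if and only if $R_\prec$ is reflexive; (ii) (D) holds if and only if $R_\prec$ is transitive, i.e. $R_\prec\circ R_\prec\subseteq R_\prec$; (iii) (T) holds if and only if $R_\prec$ is dense, i.e. $R_\prec\subseteq R_\prec\circ R_\prec$; (iv) ($a=\bot$ or $\blacksquare a\ne\bot$ for every $a\in A$) if and only if $R_\prec$ is proper. -/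

import Mathlib

namespace SubLat

/-! ### Subordination lattices -/

/-- A subordination on a bounded lattice. -/
structure IsSubordination {A : Type*} [Lattice A] [BoundedOrder A] (r : A → A → Prop) :
    Prop where
  bot : r ⊥ ⊥
  top : r ⊤ ⊤
  si : ∀ {a b x : A}, a ≤ b → r b x → r a x
  wo : ∀ {b x y : A}, r b x → x ≤ y → r b y
  and : ∀ {a x y : A}, r a x → r a y → r a (x ⊓ y)
  or : ∀ {a b x : A}, r a x → r b x → r (a ⊔ b) x

/-- The inclusion of the subordination in the lattice order. -/
def SubLe {A : Type*} [LE A] (r : A → A → Prop) : Prop :=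
  ∀ a b : A, r a b → a ≤ b

/-- Condition (D): interpolation. -/
def CondD {A : Type*} (r : A → A → Prop) : Prop :=
  ∀ a c : A, r a c → ∃ b : A, r a b ∧ r b c

/-- Condition (T): transitivity. -/
def CondT {A : Type*} (r : A → A → Prop) : Prop :=
  ∀ a b c : A, r a b → r b c → r a c

/-! ### Canonical extensions -/

section CanonicalExtension

variable {A C : Type*} [PartialOrder A] [CompleteLattice C]

/-- Closed elements: meets of (nonempty) down-directed subsets of `A`. -/
def IsClosedElt (e : A ↪o C) (k : C) : Prop :=
  ∃ F : Set A, F.Nonempty ∧ DirectedOn (· ≥ ·) F ∧ k = sInf (e '' F)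

/-- Open elements: joins of (nonempty) up-directed subsets of `A`. -/
def IsOpenElt (e : A ↪o C) (o : C) : Prop :=
  ∃ I : Set A, I.Nonempty ∧ DirectedOn (· ≤ ·) I ∧ o = sSup (e '' I)

/-- The embedding `e` of the poset `A` in the complete lattice `C` presents `C` as the canonical
extension of `A`: it is dense and compact. -/
structure IsCanonicalExtension (e : A ↪o C) : Prop where
  dense_closed : ∀ u : C, ∃ S : Set C, (∀ k ∈ S, IsClosedElt e k) ∧ u = sSup S
  dense_open : ∀ u : C, ∃ S : Set C, (∀ o ∈ S, IsOpenElt e o) ∧ u = sInf S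
  compact : ∀ F I : Set A, F.Nonempty → DirectedOn (· ≥ ·) F →
    I.Nonempty → DirectedOn (· ≤ ·) I →
    sInf (e '' F) ≤ sSup (e '' I) → ∃ a ∈ F, ∃ b ∈ I, a ≤ b

/-- `◇ a`, the meet of all `b` with `a ≺ b`. -/
def diamond (e : A ↪o C) (r : A → A → Prop) (a : A) : C :=
  sInf (e '' {b | r a b})

/-- `■ a`, the join of all `b` with `b ≺ a`. -/
def blackbox (e : A ↪o C) (r : A → A → Prop) (a : A) : C :=
  sSup (e '' {b | r b a})

/-- The value of the extension of `◇` at a closed element `k`: the meet of all `◇ a` with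
`k ≤ a`. -/
def diamondClosed (e : A ↪o C) (r : A → A → Prop) (k : C) : C :=
  sInf {x | ∃ a : A, k ≤ e a ∧ x = diamond e r a}

/-- The extension of `◇` to the whole canonical extension. -/
def diamondExt (e : A ↪o C) (r : A → A → Prop) (u : C) : C :=
  sSup {x | ∃ k : C, IsClosedElt e k ∧ k ≤ u ∧ x = diamondClosed e r k}

end CanonicalExtension

/-! ### Subordination spaces -/

/-- A relation on an ordered topological space is proper if no proper closed down-set `Y` has
`R⁻¹[Y]` equal to the whole space. -/
def IsProperRel {X : Type*} [Preorder X] [TopologicalSpace X] (R : X → X → Prop) : Prop :=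
  ∀ Y : Set X, IsClosed Y → IsLowerSet Y → Y ≠ Set.univ → ∃ P : X, P ∉ {P | ∃ Q ∈ Y, R P Q}

/-- The set of prime filters of a bounded lattice, ordered by inclusion. -/
def PrimeFilter (A : Type*) [Lattice A] [BoundedOrder A] : Type _ :=
  {F : Order.PFilter A // F.IsPrime}

section PrimeFilter

variable {A : Type*} [Lattice A] [BoundedOrder A]

instance : PartialOrder (PrimeFilter A) :=
  inferInstanceAs (PartialOrder {F : Order.PFilter A // F.IsPrime})

/-- The Priestley topology. -/
instance : TopologicalSpace (PrimeFilter A) :=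
  TopologicalSpace.generateFrom
    {U | ∃ a : A, U = {P : PrimeFilter A | a ∈ P.1} ∨ U = {P : PrimeFilter A | a ∉ P.1}}

/-- The dual relation on prime filters: `≺[P] ⊆ Q`. -/
def relPF (r : A → A → Prop) (P Q : PrimeFilter A) : Prop :=
  {x : A | ∃ a ∈ P.1, r a x} ⊆ {x : A | x ∈ Q.1}

end PrimeFilter

/-- Complete join-irreducibility; taking `S = ∅` shows that `⊥` is excluded. -/
def IsCompletelyJoinIrred {C : Type*} [CompleteLattice C] (j : C) : Prop :=
  ∀ S : Set C, j = sSup S → j ∈ S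

/-- The set of completely join-irreducible elements of the canonical extension given by `e`. -/
def JInf {A C : Type*} [PartialOrder A] [CompleteLattice C] (_e : A ↪o C) : Type _ :=
  {j : C // IsCompletelyJoinIrred j}

section JInf

variable {A C : Type*} [PartialOrder A] [CompleteLattice C] {e : A ↪o C}

/-- The order of the dual space is the reverse of the order of the canonical extension (inclusion
of prime filters corresponds to `≥`). -/
instance : PartialOrder (JInf e) :=
  inferInstanceAs (PartialOrder {j : C // IsCompletelyJoinIrred j}ᵒᵈ)

theorem JInf.le_def (i j : JInf e) : i ≤ j ↔ j.1 ≤ i.1 := Iff.rfl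

/-- The Priestley topology. -/
instance : TopologicalSpace (JInf e) :=
  TopologicalSpace.generateFrom
    {U | ∃ a : A, U = {j : JInf e | j.1 ≤ e a} ∨ U = {j : JInf e | ¬ j.1 ≤ e a}}

/-- The dual relation on completely join-irreducible elements: `i ≤ ◇ j`. -/
def relJ (e : A ↪o C) (r : A → A → Prop) (j i : JInf e) : Prop :=
  i.1 ≤ diamondExt e r j.1

end JInf

/-! ### Every lattice has a canonical extension -/

section Existence

variable (A : Type*) [Lattice A]

/-- A filter and an ideal are related if they meet. -/
def Meets (F : Order.PFilter A) (I : Order.Ideal A) : Prop := ∃ a : A, a ∈ F ∧ a ∈ I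

/-- A concrete model of the canonical extension of a lattice. -/
abbrev CanExt : Type _ := Concept (Order.PFilter A) (Order.Ideal A) (Meets A)

variable {A}

/-- The element of the concrete model given by an element of the lattice. -/
def CanExt.of (a : A) : CanExt A where
  extent := {F | a ∈ F}
  intent := {I | a ∈ I}
  upperPolar_extent := by
    ext I
    constructor
    · intro h
      obtain ⟨b, hb, hbI⟩ := h (a := Order.PFilter.principal a)
        (Order.PFilter.mem_principal.2 le_rfl)
      exact I.lower (Order.PFilter.mem_principal.1 hb) hbI
    · intro h F hF
      exact ⟨a, hF, h⟩
  lowerPolar_intent := by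
    ext F
    constructor
    · intro h
      obtain ⟨b, hb, hbI⟩ := h (b := Order.Ideal.principal a)
        (Order.Ideal.mem_principal.2 le_rfl)
      exact Order.PFilter.mem_of_le (Order.Ideal.mem_principal.1 hbI) hb
    · intro h I hI
      exact ⟨a, h, hI⟩

/-- The embedding of a lattice in the concrete model of its canonical extension. -/
def CanExt.emb : A ↪o CanExt A :=
  OrderEmbedding.ofMapLEIff CanExt.of (by
    intro a b
    rw [← Concept.extent_subset_extent_iff]
    constructor
    · intro h
      have ha : Order.PFilter.principal a ∈ (CanExt.of a).extent :=
        Order.PFilter.mem_principal.2 le_rfl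
      exact Order.PFilter.mem_principal.1 (h ha)
    · intro h F hF
      exact Order.PFilter.mem_of_le h hF)

theorem CanExt.mem_sInf_extent (D : Set A) (G : Order.PFilter A) :
    G ∈ (sInf (CanExt.emb '' D)).extent ↔ ∀ a ∈ D, a ∈ G := by
  rw [Concept.extent_sInf]
  simp only [Set.mem_iInter, Set.forall_mem_image]
  exact Iff.rfl

theorem CanExt.mem_sSup_intent (D : Set A) (I : Order.Ideal A) :
    I ∈ (sSup (CanExt.emb '' D)).intent ↔ ∀ a ∈ D, a ∈ I := by
  rw [Concept.intent_sSup]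
  simp only [Set.mem_iInter, Set.forall_mem_image]
  exact Iff.rfl

/-- The concrete model is a canonical extension. -/
theorem CanExt.isCanonicalExtension : IsCanonicalExtension (CanExt.emb (A := A)) where
  dense_closed u := by
    refine ⟨{k | ∃ F ∈ u.extent, k = sInf (CanExt.emb '' (F : Set A))}, ?_, ?_⟩
    · rintro k ⟨F, -, rfl⟩
      exact ⟨F, F.nonempty, F.directed, rfl⟩
    · apply le_antisymm
      · intro F hF
        have hle : sInf (CanExt.emb '' (F : Set A)) ≤
            sSup {k | ∃ F ∈ u.extent, k = sInf (CanExt.emb '' (F : Set A))} :=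
          le_sSup ⟨F, hF, rfl⟩
        exact Concept.extent_subset_extent_iff.2 hle
          ((CanExt.mem_sInf_extent _ _).2 fun a ha => ha)
      · apply sSup_le
        rintro k ⟨F, hF, rfl⟩ G hG
        rw [CanExt.mem_sInf_extent] at hG
        rw [← u.lowerPolar_intent] at hF ⊢
        intro I hI
        obtain ⟨a, haF, haI⟩ := hF hI
        exact ⟨a, hG a haF, haI⟩
  dense_open u := by
    refine ⟨{k | ∃ I ∈ u.intent, k = sSup (CanExt.emb '' (I : Set A))}, ?_, ?_⟩
    · rintro k ⟨I, -, rfl⟩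
      exact ⟨I, I.nonempty, I.directed, rfl⟩
    · apply le_antisymm
      · apply le_sInf
        rintro k ⟨I, hI, rfl⟩
        rw [← Concept.intent_subset_intent_iff]
        intro J hJ
        rw [CanExt.mem_sSup_intent] at hJ
        rw [← u.upperPolar_extent] at hI ⊢
        intro F hF
        obtain ⟨a, haF, haI⟩ := hI hF
        exact ⟨a, haF, hJ a haI⟩
      · rw [← Concept.intent_subset_intent_iff]
        intro I hI
        have hle : sInf {k | ∃ I ∈ u.intent, k = sSup (CanExt.emb '' (I : Set A))} ≤
            sSup (CanExt.emb '' (I : Set A)) :=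
          sInf_le ⟨I, hI, rfl⟩
        exact Concept.intent_subset_intent_iff.2 hle
          ((CanExt.mem_sSup_intent _ _).2 fun a ha => ha)
  compact F I hF hFd hI hId h := by
    have hF' : Order.IsPFilter {x : A | ∃ a ∈ F, a ≤ x} := by
      refine Order.IsPFilter.of_def ?_ ?_ ?_
      · obtain ⟨a, ha⟩ := hF
        exact ⟨a, a, ha, le_rfl⟩
      · rintro x ⟨a, ha, hax⟩ y ⟨b, hb, hby⟩
        obtain ⟨c, hc, hca, hcb⟩ := hFd a ha b hb
        exact ⟨c, ⟨c, hc, le_rfl⟩, le_trans hca hax, le_trans hcb hby⟩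
      · rintro x y hxy ⟨a, ha, hax⟩
        exact ⟨a, ha, hax.trans hxy⟩
    have hI' : Order.IsIdeal {x : A | ∃ b ∈ I, x ≤ b} := by
      refine ⟨?_, ?_, ?_⟩
      · rintro x y hyx ⟨b, hb, hxb⟩
        exact ⟨b, hb, hyx.trans hxb⟩
      · obtain ⟨b, hb⟩ := hI
        exact ⟨b, b, hb, le_rfl⟩
      · rintro x ⟨a, ha, hxa⟩ y ⟨b, hb, hyb⟩
        obtain ⟨c, hc, hac, hbc⟩ := hId a ha b hb
        exact ⟨c, ⟨c, hc, le_rfl⟩, le_trans hxa hac, le_trans hyb hbc⟩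
    have h1 : hF'.toPFilter ∈ (sInf (CanExt.emb '' F)).extent :=
      (CanExt.mem_sInf_extent _ _).2 fun a ha => ⟨a, ha, le_rfl⟩
    have h2 : hI'.toIdeal ∈ (sSup (CanExt.emb '' I)).intent :=
      (CanExt.mem_sSup_intent _ _).2 fun a ha => ⟨a, ha, le_rfl⟩
    obtain ⟨c, ⟨a, ha, hac⟩, ⟨b, hb, hcb⟩⟩ := Concept.rel_extent_intent (h h1) h2
    exact ⟨a, ha, b, hb, hac.trans hcb⟩

end Existence

end SubLat

namespace SubLat

open Set

/-! ### Prime filters -/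

section PrimeFilter

variable {A : Type*}

section Lattice

variable [Lattice A] [BoundedOrder A]

/-! The four equivalences are proved on prime filters and carried over along `P ↦ ⋀ P`. On prime
filters they rest on the prime filter theorem: `≺` sends filters forward to filters and ideals
backward to ideals, so successors and predecessors under `relPF` arise by separating a filter from
an ideal (`exists_relPF_of_forall_notMem`, `exists_relPF_of_forall_mem`). Properness also needs
compactness of the Priestley topology.

For the isomorphism, compactness of the extension turns `⋀ P ≤ e a` into `a ∈ P`, which settles
order, topology and relation. Density by open elements makes `⋀ P` completely join-irreducible.
Conversely, every element is a join of closed ones and every closed element a join of such meets, so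
a completely join-irreducible element is one of them. -/

theorem PrimeFilter.bot_notMem (P : PrimeFilter A) : (⊥ : A) ∉ P.1 := by
  obtain ⟨x, hx⟩ := P.2.compl_ideal.Nonempty
  exact fun h => hx (Order.PFilter.mem_of_le bot_le h)

theorem PrimeFilter.sup_mem (P : PrimeFilter A) {a b : A} (h : a ⊔ b ∈ P.1) :
    a ∈ P.1 ∨ b ∈ P.1 := by
  by_contra! hab
  obtain ⟨c, hc, hac, hbc⟩ := P.2.compl_ideal.Directed a hab.1 b hab.2
  exact hc (Order.PFilter.mem_of_le (sup_le hac hbc) h)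

theorem PrimeFilter.isIdeal_compl (P : PrimeFilter A) : Order.IsIdeal {a : A | a ∉ P.1} :=
  P.2.compl_ideal

theorem PrimeFilter.le_iff {P Q : PrimeFilter A} : P ≤ Q ↔ ∀ a ∈ P.1, a ∈ Q.1 := Iff.rfl

theorem isPFilter_of_inf {F : Set A} (top : ⊤ ∈ F) (inf : ∀ x ∈ F, ∀ y ∈ F, x ⊓ y ∈ F)
    (up : ∀ x y, x ≤ y → x ∈ F → y ∈ F) : Order.IsPFilter F :=
  .of_def ⟨⊤, top⟩ (fun x hx y hy => ⟨x ⊓ y, inf x hx y hy, inf_le_left, inf_le_right⟩)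
    (up _ _)

theorem isIdeal_of_sup {I : Set A} (bot : ⊥ ∈ I) (sup : ∀ x ∈ I, ∀ y ∈ I, x ⊔ y ∈ I)
    (down : ∀ x y, x ≤ y → y ∈ I → x ∈ I) : Order.IsIdeal I :=
  ⟨fun _ _ h hx => down _ _ h hx, ⟨⊥, bot⟩,
    fun x hx y hy => ⟨x ⊔ y, sup x hx y hy, le_sup_left, le_sup_right⟩⟩

/-- A prime filter from a subset with the first-order closure properties of one. -/
def PrimeFilter.ofSet (F : Set A) (top : ⊤ ∈ F) (bot : ⊥ ∉ F)
    (inf : ∀ x ∈ F, ∀ y ∈ F, x ⊓ y ∈ F) (up : ∀ x y, x ≤ y → x ∈ F → y ∈ F)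
    (sup : ∀ x y, x ⊔ y ∈ F → x ∈ F ∨ y ∈ F) : PrimeFilter A :=
  ⟨(isPFilter_of_inf top inf up).toPFilter,
    ⟨isIdeal_of_sup bot (fun x hx y hy h => (sup x y h).elim hx hy)
      (fun x y hxy hy hx => hy (up x y hxy hx))⟩⟩

theorem PrimeFilter.isClopen_mem (a : A) : IsClopen {P : PrimeFilter A | a ∈ P.1} :=
  ⟨⟨TopologicalSpace.isOpen_generateFrom_of_mem ⟨a, Or.inr rfl⟩⟩,
    TopologicalSpace.isOpen_generateFrom_of_mem ⟨a, Or.inl rfl⟩⟩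

/-- An ultrafilter `U` converges to the prime filter of those `a` whose basic clopen set belongs to
`U`; primality holds because an ultrafilter containing a union contains one of its members. -/
instance : CompactSpace (PrimeFilter A) := by
  refine ⟨isCompact_iff_ultrafilter_le_nhds.2 fun U _ => ?_⟩
  refine ⟨PrimeFilter.ofSet {a | {P : PrimeFilter A | a ∈ P.1} ∈ U} ?_ ?_ ?_ ?_ ?_,
    mem_univ _, ?_⟩
  · exact Filter.mem_of_superset Filter.univ_mem fun P _ => Order.PFilter.top_mem
  · intro h
    obtain ⟨P, hP⟩ := U.nonempty_of_mem h
    exact P.bot_notMem hP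
  · intro x hx y hy
    exact Filter.mem_of_superset (Filter.inter_mem hx hy) fun P hP =>
      Order.PFilter.inf_mem hP.1 hP.2
  · intro x y hxy hx
    exact Filter.mem_of_superset hx fun P hP => Order.PFilter.mem_of_le hxy hP
  · intro x y h
    exact Ultrafilter.union_mem_iff.1 (Filter.mem_of_superset h fun P hP => P.sup_mem hP)
  · rw [TopologicalSpace.nhds_generateFrom]
    refine le_iInf₂ fun s hs => Filter.le_principal_iff.2 ?_
    obtain ⟨hs, a, rfl | rfl⟩ := hs
    · exact hs
    · exact Ultrafilter.compl_mem_iff_notMem.2 hs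

/-- A point outside a closed down-set is separated from it by an element of the lattice. -/
theorem PrimeFilter.exists_mem_of_isClosed_of_isLowerSet {Y : Set (PrimeFilter A)}
    (hc : IsClosed Y) (hl : IsLowerSet Y) {P : PrimeFilter A} (hP : P ∉ Y) :
    ∃ a ∈ P.1, ∀ Q ∈ Y, a ∉ Q.1 := by
  have : Nonempty P.1 := ⟨⟨⊤, Order.PFilter.top_mem⟩⟩
  obtain ⟨a, ha⟩ := hc.isCompact.elim_directed_family_closed
    (fun a : P.1 => {Q : PrimeFilter A | (a : A) ∈ Q.1}) (fun a => (isClopen_mem _).1) (by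
      -- A point of `Y` in all these clopen sets would contain `P`, and the down-set `Y` would then
      -- contain `P`.
      refine eq_empty_of_forall_notMem fun Q hQ => hP (hl ?_ hQ.1)
      exact PrimeFilter.le_iff.2 fun a ha => mem_iInter.1 hQ.2 ⟨a, ha⟩) (by
      intro a b
      exact ⟨⟨a ⊓ b, Order.PFilter.inf_mem a.2 b.2⟩,
        fun Q hQ => Order.PFilter.mem_of_le inf_le_left hQ,
        fun Q hQ => Order.PFilter.mem_of_le inf_le_right hQ⟩)
  exact ⟨a, a.2, fun Q hQ haQ => eq_empty_iff_forall_notMem.1 ha Q ⟨hQ, haQ⟩⟩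

end Lattice

variable [DistribLattice A] [BoundedOrder A]

/-- The prime filter theorem. -/
theorem exists_primeFilter {F I : Set A} (hF : Order.IsPFilter F) (hI : Order.IsIdeal I)
    (h : ∀ x ∈ F, x ∉ I) :
    ∃ P : PrimeFilter A, (∀ x ∈ F, x ∈ P.1) ∧ ∀ x ∈ I, x ∉ P.1 := by
  obtain ⟨J, hJ, hIJ, hFJ⟩ := DistribLattice.prime_ideal_of_disjoint_filter_ideal
    (F := hF.toPFilter) (I := hI.toIdeal) (Set.disjoint_left.2 h)
  exact ⟨⟨_, hJ.toPrimePair.F_isPrime⟩, fun x hx => Set.disjoint_left.1 hFJ hx,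
    fun x hx hxF => hxF (hIJ hx)⟩

theorem exists_primeFilter_of_notMem {F : Set A} (hF : Order.IsPFilter F) {b : A} (hb : b ∉ F) :
    ∃ P : PrimeFilter A, (∀ x ∈ F, x ∈ P.1) ∧ b ∉ P.1 := by
  have hI : Order.IsIdeal {x : A | x ≤ b} := (Order.Ideal.principal b).isIdeal
  obtain ⟨P, hP, hPb⟩ := exists_primeFilter hF hI
    fun x hx (hxb : x ≤ b) => hb (hF.toPFilter.mem_of_le hxb hx)
  exact ⟨P, hP, hPb b le_rfl⟩

theorem exists_primeFilter_of_not_le {a b : A} (h : ¬ a ≤ b) :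
    ∃ P : PrimeFilter A, a ∈ P.1 ∧ b ∉ P.1 := by
  obtain ⟨P, hP, hb⟩ := exists_primeFilter_of_notMem (Order.PFilter.principal a).isPFilter
    (b := b) h
  exact ⟨P, hP a le_rfl, hb⟩

theorem exists_primeFilter_of_mem {I : Set A} (hI : Order.IsIdeal I) {a : A} (ha : a ∉ I) :
    ∃ P : PrimeFilter A, a ∈ P.1 ∧ ∀ x ∈ I, x ∉ P.1 := by
  obtain ⟨P, hP, hPI⟩ := exists_primeFilter (Order.PFilter.principal a).isPFilter hI
    fun x (hx : a ≤ x) hxI => ha (hI.IsLowerSet hx hxI)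
  exact ⟨P, hP a le_rfl, hPI⟩

end PrimeFilter

/-! ### The dual relation on prime filters -/

section Relation

variable {A : Type*} [DistribLattice A] [BoundedOrder A] {r : A → A → Prop}

theorem IsSubordination.isPFilter_image (hr : IsSubordination r) {F : Set A}
    (hF : Order.IsPFilter F) : Order.IsPFilter {x : A | ∃ a ∈ F, r a x} := by
  refine isPFilter_of_inf ?_ ?_ ?_
  · obtain ⟨a, ha⟩ := hF.toPFilter.nonempty
    exact ⟨a, ha, hr.si le_top hr.top⟩
  · rintro x ⟨a, ha, hax⟩ y ⟨b, hb, hby⟩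
    exact ⟨a ⊓ b, hF.toPFilter.inf_mem ha hb,
      hr.and (hr.si inf_le_left hax) (hr.si inf_le_right hby)⟩
  · rintro x y hxy ⟨a, ha, hax⟩
    exact ⟨a, ha, hr.wo hax hxy⟩

theorem IsSubordination.isPFilter_setOf (hr : IsSubordination r) (a : A) :
    Order.IsPFilter {x : A | r a x} :=
  isPFilter_of_inf (hr.si le_top hr.top) (fun _ hx _ hy => hr.and hx hy)
    (fun _ _ hxy hx => hr.wo hx hxy)

theorem IsSubordination.isIdeal_preimage (hr : IsSubordination r) {I : Set A}
    (hI : Order.IsIdeal I) : Order.IsIdeal {x : A | ∃ b ∈ I, r x b} := by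
  refine isIdeal_of_sup ?_ ?_ ?_
  · obtain ⟨a, ha⟩ := hI.toIdeal.nonempty
    exact ⟨a, ha, hr.wo hr.bot bot_le⟩
  · rintro x ⟨a, ha, hax⟩ y ⟨b, hb, hby⟩
    exact ⟨a ⊔ b, hI.toIdeal.sup_mem ha hb,
      hr.or (hr.wo hax le_sup_left) (hr.wo hby le_sup_right)⟩
  · rintro x y hxy ⟨b, hb, hyb⟩
    exact ⟨b, hb, hr.si hxy hyb⟩

theorem IsSubordination.isIdeal_setOf (hr : IsSubordination r) (b : A) :
    Order.IsIdeal {x : A | r x b} :=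
  isIdeal_of_sup (hr.wo hr.bot bot_le) (fun _ hx _ hy => hr.or hx hy)
    (fun _ _ hxy hy => hr.si hxy hy)

theorem relPF_apply {P Q : PrimeFilter A} (h : relPF r P Q) {a b : A} (ha : a ∈ P.1)
    (hab : r a b) : b ∈ Q.1 :=
  h ⟨a, ha, hab⟩

/-- The predecessors of `Q` are the prime filters that miss the ideal of elements subordinate to
something outside `Q`. -/
theorem exists_relPF_of_forall_mem (hr : IsSubordination r) {a : A} {Q : PrimeFilter A}
    (h : ∀ x, r a x → x ∈ Q.1) : ∃ P : PrimeFilter A, a ∈ P.1 ∧ relPF r P Q := by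
  obtain ⟨P, haP, hP⟩ := exists_primeFilter_of_mem (hr.isIdeal_preimage Q.isIdeal_compl)
    (a := a) fun ⟨b, hb, hab⟩ => hb (h b hab)
  refine ⟨P, haP, ?_⟩
  rintro x ⟨b, hb, hbx⟩
  by_contra hx
  exact hP b ⟨x, hx, hbx⟩ hb

theorem exists_relPF_of_forall_notMem (hr : IsSubordination r) {b : A} {P : PrimeFilter A}
    (h : ∀ x ∈ P.1, ¬ r x b) : ∃ Q : PrimeFilter A, relPF r P Q ∧ b ∉ Q.1 := by
  obtain ⟨Q, hQ, hb⟩ := exists_primeFilter_of_notMem (hr.isPFilter_image P.1.isPFilter)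
    (b := b) fun ⟨a, ha, hab⟩ => h a ha hab
  exact ⟨Q, fun x hx => hQ x hx, hb⟩

theorem subLe_iff_relPF_refl : SubLe r ↔ ∀ P : PrimeFilter A, relPF r P P := by
  constructor
  · rintro h P x ⟨a, ha, hax⟩
    exact Order.PFilter.mem_of_le (h a x hax) ha
  · intro h a b hab
    by_contra hle
    obtain ⟨P, ha, hb⟩ := exists_primeFilter_of_not_le hle
    exact hb (relPF_apply (h P) ha hab)

/-- Without an interpolant for `a ≺ c`, the filter above `a` and the ideal below `c` (both with
respect to `≺`) are disjoint. A prime filter `Q` separating them has a predecessor containing `a`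
and a successor omitting `c`, so transitivity contradicts `a ≺ c`. -/
theorem condD_iff_relPF_trans (hr : IsSubordination r) :
    CondD r ↔ ∀ P Q S : PrimeFilter A, relPF r P Q → relPF r Q S → relPF r P S := by
  constructor
  · rintro h P Q S hPQ hQS x ⟨a, ha, hax⟩
    obtain ⟨b, hab, hbx⟩ := h a x hax
    exact relPF_apply hQS (relPF_apply hPQ ha hab) hbx
  · intro h a c hac
    by_contra! hno
    obtain ⟨Q, haQ, hQc⟩ := exists_primeFilter (hr.isPFilter_setOf a) (hr.isIdeal_setOf c) hno
    obtain ⟨P, haP, hPQ⟩ := exists_relPF_of_forall_mem hr haQ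
    obtain ⟨S, hQS, hcS⟩ := exists_relPF_of_forall_notMem hr fun x hx hxc => hQc x hxc hx
    exact hcS (relPF_apply (h P Q S hPQ hQS) haP hac)

/-- Under (T), a common element of the image of `P` and the preimage of the complement of `S` would
violate `relPF r P S`; a prime filter separating the two is the midpoint. -/
theorem condT_iff_relPF_dense (hr : IsSubordination r) :
    CondT r ↔ ∀ P S : PrimeFilter A, relPF r P S → ∃ Q, relPF r P Q ∧ relPF r Q S := by
  constructor
  · intro h P S hPS
    obtain ⟨Q, hPQ, hQS⟩ := exists_primeFilter (hr.isPFilter_image P.1.isPFilter)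
      (hr.isIdeal_preimage S.isIdeal_compl) (by
        rintro x ⟨a, ha, hax⟩ ⟨b, hb, hxb⟩
        exact hb (relPF_apply hPS ha (h a x b hax hxb)))
    refine ⟨Q, fun x hx => hPQ x hx, ?_⟩
    rintro x ⟨b, hb, hbx⟩
    by_contra hx
    exact hQS b ⟨x, hx, hbx⟩ hb
  · intro h a b c hab hbc
    by_contra hac
    obtain ⟨S, haS, hcS⟩ := exists_primeFilter_of_notMem (hr.isPFilter_setOf a) hac
    obtain ⟨P, haP, hPS⟩ := exists_relPF_of_forall_mem hr haS
    obtain ⟨Q, hPQ, hQS⟩ := h P S hPS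
    exact hcS (relPF_apply hQS (relPF_apply hPQ haP hab) hbc)

theorem isProperRel_relPF_iff (hr : IsSubordination r) :
    IsProperRel (X := PrimeFilter A) (relPF r) ↔ ∀ a : A, a ≠ ⊥ → ∃ b, r b a ∧ b ≠ ⊥ := by
  constructor
  · intro h a ha
    have hne : {Q : PrimeFilter A | a ∉ Q.1} ≠ univ := by
      obtain ⟨P, haP, -⟩ := exists_primeFilter_of_not_le (b := ⊥) (mt le_bot_iff.1 ha)
      exact fun hu => (hu.symm ▸ mem_univ P : P ∈ {Q : PrimeFilter A | a ∉ Q.1}) haP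
    obtain ⟨P, hP⟩ := h {Q | a ∉ Q.1} (PrimeFilter.isClopen_mem a).compl.1
      (fun P Q hQP hP ha => hP (hQP ha)) hne
    by_contra! hno
    -- If only `⊥` is subordinate to `a`, no element of `P` is, so `P` has a successor omitting `a`.
    obtain ⟨Q, hPQ, haQ⟩ := exists_relPF_of_forall_notMem hr (P := P) (b := a)
      fun x hx hxa => P.bot_notMem (hno x hxa ▸ hx)
    exact hP ⟨Q, haQ, hPQ⟩
  · intro h Y hc hl hne
    obtain ⟨P, hP⟩ := (ne_univ_iff_exists_notMem Y).1 hne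
    obtain ⟨a, haP, haY⟩ := PrimeFilter.exists_mem_of_isClosed_of_isLowerSet hc hl hP
    obtain ⟨b, hba, hb⟩ := h a fun ha => P.bot_notMem (ha ▸ haP)
    obtain ⟨S, hbS, -⟩ := exists_primeFilter_of_not_le (b := ⊥) (mt le_bot_iff.1 hb)
    exact ⟨S, fun ⟨Q, hQ, hSQ⟩ => haY Q hQ (relPF_apply hSQ hbS hba)⟩

end Relation

/-! ### Completely join-irreducible elements of the canonical extension -/

section CanonicalExtension

variable {A C : Type*} [DistribLattice A] [BoundedOrder A] [CompleteLattice C] {e : A ↪o C}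

theorem IsCanonicalExtension.map_bot (he : IsCanonicalExtension e) : e ⊥ = ⊥ := by
  obtain ⟨S, hS, hbot⟩ := he.dense_open ⊥
  rw [eq_bot_iff, hbot]
  refine le_sInf fun o ho => ?_
  -- Nonemptiness of `I` puts every open element above `e ⊥`.
  obtain ⟨I, ⟨a, ha⟩, -, rfl⟩ := hS o ho
  exact (e.monotone bot_le).trans (le_sSup (mem_image_of_mem e ha))

/-- The meet of a prime filter in the canonical extension. -/
def primeMeet (e : A ↪o C) (P : PrimeFilter A) : C := ⨅ a ∈ P.1, e a

theorem primeMeet_eq_sInf (P : PrimeFilter A) : primeMeet e P = sInf (e '' P.1) :=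
  sInf_image.symm

theorem isClosedElt_primeMeet (P : PrimeFilter A) : IsClosedElt e (primeMeet e P) :=
  ⟨P.1, P.1.nonempty, P.1.directed, primeMeet_eq_sInf P⟩

theorem IsCanonicalExtension.primeMeet_le_sSup_iff (he : IsCanonicalExtension e)
    {P : PrimeFilter A} {I : Set A} (hne : I.Nonempty) (hI : DirectedOn (· ≤ ·) I) :
    primeMeet e P ≤ sSup (e '' I) ↔ ∃ a ∈ I, a ∈ P.1 := by
  constructor
  · intro h
    rw [primeMeet_eq_sInf] at h
    obtain ⟨a, ha, b, hb, hab⟩ := he.compact _ I P.1.nonempty P.1.directed hne hI h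
    exact ⟨b, hb, Order.PFilter.mem_of_le hab ha⟩
  · rintro ⟨a, haI, haP⟩
    exact (iInf₂_le a haP).trans (le_sSup (mem_image_of_mem e haI))

theorem IsCanonicalExtension.primeMeet_le_iff (he : IsCanonicalExtension e)
    {P : PrimeFilter A} {a : A} : primeMeet e P ≤ e a ↔ a ∈ P.1 := by
  simpa using he.primeMeet_le_sSup_iff (P := P) (singleton_nonempty a) (directedOn_singleton a)

theorem IsCanonicalExtension.primeMeet_le_primeMeet_iff (he : IsCanonicalExtension e)
    {P Q : PrimeFilter A} : primeMeet e P ≤ primeMeet e Q ↔ Q ≤ P := by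
  simp only [PrimeFilter.le_iff, primeMeet, le_iInf_iff]
  exact forall₂_congr fun a _ => he.primeMeet_le_iff

/-- Any `s` not above `⋀ P` lies below an open element not above `⋀ P`, hence below the join of the
complement of `P`. By compactness that join is not above `⋀ P`, so `⋀ P` is not a join of such `s`.
-/
theorem IsCanonicalExtension.isCompletelyJoinIrred_primeMeet (he : IsCanonicalExtension e)
    (P : PrimeFilter A) : IsCompletelyJoinIrred (primeMeet e P) := by
  intro S hS
  by_contra hmem
  have hle : primeMeet e P ≤ sSup (e '' {a | a ∉ P.1}) := by
    conv_lhs => rw [hS]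
    refine sSup_le fun s hs => ?_
    have hns : ¬ primeMeet e P ≤ s := fun h =>
      hmem ((h.antisymm (hS ▸ le_sSup hs)).symm ▸ hs)
    obtain ⟨T, hT, rfl⟩ := he.dense_open s
    simp only [le_sInf_iff, not_forall] at hns
    obtain ⟨o, ho, hPo⟩ := hns
    obtain ⟨I, hne, hI, rfl⟩ := hT o ho
    refine (sInf_le ho).trans (sSup_le_sSup (image_mono fun a ha haP => hPo ?_))
    exact (he.primeMeet_le_sSup_iff hne hI).2 ⟨a, ha, haP⟩
  obtain ⟨a, ha, haP⟩ := (he.primeMeet_le_sSup_iff P.isIdeal_compl.Nonempty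
    P.isIdeal_compl.Directed).1 hle
  exact ha haP

/-- A closed element is the join of the meets of the prime filters above it. -/
theorem IsCanonicalExtension.eq_sSup_primeMeet_of_isClosedElt (he : IsCanonicalExtension e)
    {k : C} (hk : IsClosedElt e k) :
    k = sSup {x | ∃ P : PrimeFilter A, primeMeet e P ≤ k ∧ x = primeMeet e P} := by
  apply le_antisymm
  · obtain ⟨F, hF, hFd, rfl⟩ := hk
    set u := sSup {x | ∃ P : PrimeFilter A, primeMeet e P ≤ sInf (e '' F) ∧ x = primeMeet e P}
      with hu
    obtain ⟨T, hT, hTu⟩ := he.dense_open u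
    rw [hTu]
    refine le_sInf fun o ho => ?_
    have huo : u ≤ o := hTu ▸ sInf_le ho
    obtain ⟨I, hne, hI, rfl⟩ := hT o ho
    -- Otherwise a prime filter contains `F` and misses `I`; its meet is one of the joinands of `u ≤
    -- ⋁ I`, which compactness forbids.
    by_contra hle
    have hF' : Order.IsPFilter {x : A | ∃ a ∈ F, a ≤ x} := by
      refine isPFilter_of_inf ⟨_, hF.some_mem, le_top⟩ ?_ ?_
      · rintro x ⟨a, ha, hax⟩ y ⟨b, hb, hby⟩
        obtain ⟨c, hc, hca, hcb⟩ := hFd a ha b hb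
        exact ⟨c, hc, le_inf (le_trans hca hax) (le_trans hcb hby)⟩
      · rintro x y hxy ⟨a, ha, hax⟩
        exact ⟨a, ha, hax.trans hxy⟩
    have hI' : Order.IsIdeal {x : A | ∃ b ∈ I, x ≤ b} := by
      refine isIdeal_of_sup ⟨_, hne.some_mem, bot_le⟩ ?_ ?_
      · rintro x ⟨a, ha, hxa⟩ y ⟨b, hb, hyb⟩
        obtain ⟨c, hc, hac, hbc⟩ := hI a ha b hb
        exact ⟨c, hc, sup_le (le_trans hxa hac) (le_trans hyb hbc)⟩
      · rintro x y hxy ⟨b, hb, hyb⟩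
        exact ⟨b, hb, hxy.trans hyb⟩
    obtain ⟨P, hFP, hIP⟩ := exists_primeFilter hF' hI' (by
      rintro x ⟨a, ha, hax⟩ ⟨b, hb, hxb⟩
      refine hle ((sInf_le (mem_image_of_mem e ha)).trans ?_)
      exact (e.monotone (hax.trans hxb)).trans (le_sSup (mem_image_of_mem e hb)))
    have hPu : primeMeet e P ≤ u := by
      refine le_sSup ⟨P, le_sInf ?_, rfl⟩
      rintro _ ⟨a, ha, rfl⟩
      exact he.primeMeet_le_iff.2 (hFP a ⟨a, ha, le_rfl⟩)
    obtain ⟨a, ha, haP⟩ := (he.primeMeet_le_sSup_iff hne hI).1 (hPu.trans huo)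
    exact hIP a ⟨a, ha, le_rfl⟩ haP
  · refine sSup_le ?_
    rintro _ ⟨P, hP, rfl⟩
    exact hP

theorem IsCanonicalExtension.exists_eq_primeMeet (he : IsCanonicalExtension e) {j : C}
    (hj : IsCompletelyJoinIrred j) : ∃ P : PrimeFilter A, primeMeet e P = j := by
  obtain ⟨S, hS, hjS⟩ := he.dense_closed j
  -- Irreducibility is used twice: `j` is one of the closed elements it is the join of, then one of
  -- the prime meets.
  obtain ⟨P, -, hP⟩ := hj _ (he.eq_sSup_primeMeet_of_isClosedElt (hS j (hj S hjS)))
  exact ⟨P, hP.symm⟩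

theorem diamondExt_of_isClosedElt {A C : Type*} [PartialOrder A] [CompleteLattice C]
    {e : A ↪o C} (r : A → A → Prop) {k : C} (hk : IsClosedElt e k) :
    diamondExt e r k = diamondClosed e r k := by
  apply le_antisymm
  · refine sSup_le ?_
    rintro _ ⟨l, -, hlk, rfl⟩
    refine sInf_le_sInf ?_
    rintro _ ⟨a, hka, rfl⟩
    exact ⟨a, hlk.trans hka, rfl⟩
  · exact le_sSup ⟨k, hk, le_rfl, rfl⟩

theorem IsCanonicalExtension.primeMeet_le_diamondExt_iff (he : IsCanonicalExtension e)
    (r : A → A → Prop) {P Q : PrimeFilter A} :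
    primeMeet e Q ≤ diamondExt e r (primeMeet e P) ↔ relPF r P Q := by
  rw [diamondExt_of_isClosedElt r (isClosedElt_primeMeet P)]
  constructor
  · rintro h x ⟨a, ha, hax⟩
    have hle : diamondClosed e r (primeMeet e P) ≤ diamond e r a :=
      sInf_le ⟨a, he.primeMeet_le_iff.2 ha, rfl⟩
    exact he.primeMeet_le_iff.1 ((h.trans hle).trans (sInf_le (mem_image_of_mem e hax)))
  · intro h
    refine le_sInf ?_
    rintro _ ⟨a, ha, rfl⟩
    refine le_sInf ?_
    rintro _ ⟨b, hab, rfl⟩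
    exact he.primeMeet_le_iff.2 (h ⟨a, he.primeMeet_le_iff.1 ha, hab⟩)

theorem IsCanonicalExtension.blackbox_ne_bot_iff (he : IsCanonicalExtension e)
    (r : A → A → Prop) {a : A} : blackbox e r a ≠ ⊥ ↔ ∃ b, r b a ∧ b ≠ ⊥ := by
  have hbot (b : A) : e b = ⊥ ↔ b = ⊥ := by rw [← he.map_bot, e.injective.eq_iff]
  simp [blackbox, sSup_eq_bot, hbot]

/-- The bijection `P ↦ ⋀ P`. -/
noncomputable def primeEquiv (he : IsCanonicalExtension e) : PrimeFilter A ≃ JInf e :=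
  Equiv.ofBijective (fun P => ⟨primeMeet e P, he.isCompletelyJoinIrred_primeMeet P⟩)
    ⟨fun P Q h => by
      have h' : primeMeet e P = primeMeet e Q := congrArg Subtype.val h
      exact le_antisymm (he.primeMeet_le_primeMeet_iff.1 h'.ge)
        (he.primeMeet_le_primeMeet_iff.1 h'.le),
    fun j => by
      obtain ⟨P, hP⟩ := he.exists_eq_primeMeet j.2
      exact ⟨P, Subtype.ext hP⟩⟩

theorem primeEquiv_val (he : IsCanonicalExtension e) (P : PrimeFilter A) :
    (primeEquiv he P).1 = primeMeet e P := rfl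

/-- The homeomorphism `P ↦ ⋀ P`. -/
noncomputable def primeHomeo (he : IsCanonicalExtension e) : PrimeFilter A ≃ₜ JInf e where
  toEquiv := primeEquiv he
  continuous_toFun := by
    refine continuous_generateFrom_iff.2 ?_
    rintro _ ⟨a, rfl | rfl⟩
    · convert (PrimeFilter.isClopen_mem a).2 using 1
      ext P
      exact he.primeMeet_le_iff
    · convert (PrimeFilter.isClopen_mem a).compl.2 using 1
      ext P
      exact he.primeMeet_le_iff.not
  continuous_invFun := by
    refine continuous_generateFrom_iff.2 ?_
    have key (j : JInf e) (a : A) : a ∈ ((primeEquiv he).symm j).1 ↔ j.1 ≤ e a := by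
      rw [← he.primeMeet_le_iff, ← primeEquiv_val he, Equiv.apply_symm_apply]
    rintro _ ⟨a, rfl | rfl⟩
    · refine TopologicalSpace.isOpen_generateFrom_of_mem ⟨a, Or.inl ?_⟩
      ext j
      exact key j a
    · refine TopologicalSpace.isOpen_generateFrom_of_mem ⟨a, Or.inr ?_⟩
      ext j
      exact (key j a).not

end CanonicalExtension

/-! ### Transport along the isomorphism, and the main theorem -/

theorem IsProperRel.of_homeomorph {X Y : Type*} [PartialOrder X] [TopologicalSpace X]
    [PartialOrder Y] [TopologicalSpace Y] (φ : X ≃ₜ Y) (hφ : ∀ x y, φ x ≤ φ y ↔ x ≤ y)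
    {R : X → X → Prop} {S : Y → Y → Prop} (hRS : ∀ x y, S (φ x) (φ y) ↔ R x y)
    (h : IsProperRel R) : IsProperRel S := by
  intro Z hc hl hne
  obtain ⟨P, hP⟩ := h (φ ⁻¹' Z) (hc.preimage φ.continuous)
    (fun x y hyx hx => hl ((hφ y x).2 hyx) hx)
    (fun hu => hne (by rw [← φ.image_preimage Z, hu, image_univ, φ.range_coe]))
  refine ⟨φ P, fun ⟨y, hy, hPy⟩ => hP ?_⟩
  obtain ⟨Q, rfl⟩ := φ.surjective y
  exact ⟨Q, hy, (hRS P Q).1 hPy⟩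

theorem isProperRel_iff_of_homeomorph {X Y : Type*} [PartialOrder X] [TopologicalSpace X]
    [PartialOrder Y] [TopologicalSpace Y] (φ : X ≃ₜ Y) (hφ : ∀ x y, φ x ≤ φ y ↔ x ≤ y)
    {R : X → X → Prop} {S : Y → Y → Prop} (hRS : ∀ x y, S (φ x) (φ y) ↔ R x y) :
    IsProperRel R ↔ IsProperRel S :=
  ⟨.of_homeomorph φ hφ hRS, .of_homeomorph φ.symm
    (fun x y => by rw [← hφ, φ.apply_symm_apply, φ.apply_symm_apply])
    (fun x y => by rw [← hRS, φ.apply_symm_apply, φ.apply_symm_apply])⟩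

end SubLat

theorem mainTheorem3 {A C : Type*} [DistribLattice A] [BoundedOrder A] [CompleteLattice C]
    (r : A → A → Prop) (hr : SubLat.IsSubordination r)
    (e : A ↪o C) (he : SubLat.IsCanonicalExtension e) :
    -- the two presentations of the subordination space are isomorphic via `P ↦ ⋀ P`
    (∃ φ : SubLat.PrimeFilter A ≃ₜ SubLat.JInf e,
      (∀ P, (φ P).1 = ⨅ a ∈ P.1, e a) ∧
      (∀ P Q, φ P ≤ φ Q ↔ P ≤ Q) ∧
      (∀ P Q, SubLat.relJ e r (φ P) (φ Q) ↔ SubLat.relPF r P Q)) ∧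
    -- the characterizations on the completely join-irreducible elements
    ((SubLat.SubLe r ↔ ∀ j, SubLat.relJ e r j j) ∧
      (SubLat.CondD r ↔
        ∀ i j k, SubLat.relJ e r i j → SubLat.relJ e r j k → SubLat.relJ e r i k) ∧
      (SubLat.CondT r ↔
        ∀ i k, SubLat.relJ e r i k → ∃ j, SubLat.relJ e r i j ∧ SubLat.relJ e r j k) ∧
      ((∀ a : A, a = ⊥ ∨ SubLat.blackbox e r a ≠ ⊥) ↔ SubLat.IsProperRel (SubLat.relJ e r))) ∧
    -- the characterizations on the prime filters
    ((SubLat.SubLe r ↔ ∀ P, SubLat.relPF r P P) ∧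
      (SubLat.CondD r ↔
        ∀ P Q S, SubLat.relPF r P Q → SubLat.relPF r Q S → SubLat.relPF r P S) ∧
      (SubLat.CondT r ↔
        ∀ P S, SubLat.relPF r P S → ∃ Q, SubLat.relPF r P Q ∧ SubLat.relPF r Q S) ∧
      ((∀ a : A, a = ⊥ ∨ SubLat.blackbox e r a ≠ ⊥) ↔
        SubLat.IsProperRel (SubLat.relPF r))) := by
  have hle (P Q) : SubLat.primeHomeo he P ≤ SubLat.primeHomeo he Q ↔ P ≤ Q :=
    he.primeMeet_le_primeMeet_iff
  have hrel (P Q) : SubLat.relJ e r (SubLat.primeHomeo he P) (SubLat.primeHomeo he Q) ↔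
      SubLat.relPF r P Q := he.primeMeet_le_diamondExt_iff r
  have hproper : (∀ a : A, a = ⊥ ∨ SubLat.blackbox e r a ≠ ⊥) ↔
      SubLat.IsProperRel (X := SubLat.PrimeFilter A) (SubLat.relPF r) := by
    rw [SubLat.isProperRel_relPF_iff hr]
    exact forall_congr' fun a => by rw [he.blackbox_ne_bot_iff, or_iff_not_imp_left]
  refine ⟨⟨SubLat.primeHomeo he, fun P => rfl, hle, hrel⟩, ⟨?_, ?_, ?_, ?_⟩,
    SubLat.subLe_iff_relPF_refl, SubLat.condD_iff_relPF_trans hr,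
    SubLat.condT_iff_relPF_dense hr, hproper⟩
  · simp only [SubLat.subLe_iff_relPF_refl, (SubLat.primeHomeo he).surjective.forall, hrel]
  · simp only [SubLat.condD_iff_relPF_trans hr, (SubLat.primeHomeo he).surjective.forall, hrel]
  · simp only [SubLat.condT_iff_relPF_dense hr, (SubLat.primeHomeo he).surjective.forall,
      (SubLat.primeHomeo he).surjective.exists, hrel]
  · exact hproper.trans
      (SubLat.isProperRel_iff_of_homeomorph (SubLat.primeHomeo he) hle hrel)
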